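/- Let $\Omega\subset\mathbb R^2$ be a bounded simply connected domain with Lipschitz boundary (for example a smoothly bounded domain, a rectangle or another polygon), with area $|\Omega|$, perimeter $|\partial\Omega|$ and outward normal derivative $\partial/\partial n$. Let $u_0$, $u_\infty$ and, for every $\beta>0$, $u_\beta$ be solutions in $H^1(\Omega)$, in the usual weak sense, of $$-\Delta u_0=1\ \text{in }\Omega,\quad u_0=0\ \text{on }\partial\Omega,\tag{P(0)}$$ $$-\Delta u_\infty=1\ \text{in }\Omega,\quad \frac{\partial u_\infty}{\partial n}=-\frac{|\Omega|}{|\partial\Omega|}\ \text{on }\partial\Omega,\quad \int_{\partial\Omega}u_\infty=0,\tag{P($\infty$)}$$ $$-\Delta u_\beta=1\ \text{in }\Omega,\quad u_\beta+\beta\frac{\partial u_\beta}{\partial n}=0\ \text{on }\partial\Omega.\tag{P($\beta$)}$$ That is, with boundary values understood as traces: $u_0$ has zero trace and $\int_\Omega\nabla u_0\cdot\nabla w=\int_\Omega w$ for all $w\in H^1(\Omega)$ with zero trace, while $\int_\Omega\nabla u_\infty\cdot\nabla w+\frac{|\Omega|}{|\partial\Omega|}\int_{\partial\Omega}w=\int_\Omega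 w$ and $\int_\Omega\nabla u_\beta\cdot\nabla w+\frac1\beta\int_{\partial\Omega}u_\beta w=\int_\Omega w$ for all $w\in H^1(\Omega)$. Put $$Q(\beta)=\int_\Omega u_\beta,\quad Q_0=\int_\Omega u_0,\quad \Sigma_\infty=\int_\Omega u_\infty,\quad \Sigma_1=-\int_{\partial\Omega}u_\infty^2,$$ $$\mathcal J_\beta(v)=\int_\Omega\bigl(2v-|\nabla v|^2\bigr)-\frac1\beta\int_{\partial\Omega}v^2,$$ $$R(\beta)=Q_0+\beta\frac{|\Omega|^2}{|\partial\Omega|}+\frac{\beta(\Sigma_\infty-Q_0)^2}{\beta(\Sigma_\infty-Q_0)-\Sigma_1},$$ where, here and below, a fraction whose denominator vanishes is read as $0$ (this can happen only if $\Sigma_1=0$ and $\Sigma_\infty=Q_0$ in the formula for $R$, as for the disk). Then $|\Omega|>0$, $|\partial\Omega|>0$, $0<Q_0\le\Sigma_\infty$ and $\Sigma_1\le0$, and for every $\beta>0$: 1. $Q(\beta)\ge R(\beta)$. 2. $R(\beta)$ is the maximum of $\mathcal J_\beta$ over all test functions $c_0+t_0u_0+t_\infty u_\infty$ with $c_0,t_0,t_\infty\in\mathbb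 R$. Every maximizing triple has $c_0=\beta|\Omega|/|\partial\Omega|$ and $t_0+t_\infty=1$, and the maximizing triple is unique if $\beta(\Sigma_\infty-Q_0)-\Sigma_1\ne0$. 3. Equivalently, $$R(\beta)=\Bigl(\beta\frac{|\Omega|^2}{|\partial\Omega|}+\Sigma_\infty+\frac{\Sigma_1}\beta\Bigr)+\frac{\Sigma_1^2}{\beta^2(\Sigma_\infty-Q_0)-\beta\Sigma_1}.$$ 4. The bound improves two older lower bounds for $Q(\beta)$: $R(\beta)\ge Q_0+\beta\frac{|\Omega|^2}{|\partial\Omega|}$, with strict inequality if $\Sigma_\infty\ne Q_0$; and $R(\beta)\ge\beta\frac{|\Omega|^2}{|\partial\Omega|}+\Sigma_\infty+\frac{\Sigma_1}\beta$, with strict inequality if $\Sigma_1\neq0$. 5. $R$ is twice differentiable at $\beta$, with $R''(\beta)=\dfrac{2\Sigma_1(\Sigma_\infty-Q_0)^3}{(\beta(\Sigma_\infty-Q_0)-\Sigma_1)^3}$. Moreover, on $(0,\infty)$ the function $R$ is strictly increasing and concave, and $Q$ is strictly increasing. -/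

import Mathlib

open MeasureTheory Set
open scoped ContDiff NNReal RealInnerProductSpace Gradient

noncomputable section

namespace SlipFlow

/-- The Euclidean plane. -/
abbrev Plane := EuclideanSpace ℝ (Fin 2)

/-- A bounded simply connected plane domain with Lipschitz boundary: near each boundary point the
domain is, in suitable Cartesian coordinates, the region above the graph of a Lipschitz function.
(Smoothly bounded domains, rectangles and other polygons are covered.) -/
structure PlaneDomain where
  carrier : Set Plane
  isOpen : IsOpen carrier
  bounded : Bornology.IsBounded carrier
  simplyConnected : IsSimplyConnected carrier
  lipschitzBoundary : ∀ x ∈ frontier carrier,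
    ∃ (T : Plane ≃ᵢ Plane) (f : ℝ → ℝ) (K : ℝ≥0) (r : ℝ), 0 < r ∧ LipschitzWith K f ∧
      ∀ y ∈ Metric.ball x r, (y ∈ carrier ↔ f (T y 0) < T y 1)

namespace PlaneDomain

section

variable (Ω : PlaneDomain)

/-- Lebesgue measure on the domain. -/
abbrev areaMeasure : Measure Plane := volume.restrict Ω.carrier

/-- Arc length (one-dimensional Hausdorff measure) on the boundary of the domain. -/
abbrev arcMeasure : Measure Plane := (μH[1] : Measure Plane).restrict (frontier Ω.carrier)

/-- The area `|Ω|`. -/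
def area : ℝ := (volume Ω.carrier).toReal

/-- The perimeter `|∂Ω|`. -/
def perimeter : ℝ := ((μH[1] : Measure Plane) (frontier Ω.carrier)).toReal

end

end PlaneDomain

/-- The parametrisation of a graph over the first axis. -/
def graphMap (f : ℝ → ℝ) (s : ℝ) : Plane := !₂[s, f s]

theorem lipschitzWith_graphMap {f : ℝ → ℝ} {K : ℝ≥0} (hf : LipschitzWith K f) :
    LipschitzWith (1 + K) (graphMap f) := by
  refine LipschitzWith.of_dist_le_mul fun s t => ?_
  have h := hf.dist_le_mul s t
  rw [EuclideanSpace.dist_eq]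
  have h0 : (0 : ℝ) ≤ dist s t := dist_nonneg
  have h1 : (0 : ℝ) ≤ K := K.2
  refine Real.sqrt_le_iff.2 ⟨by positivity, ?_⟩
  simp only [graphMap, Fin.sum_univ_two, NNReal.coe_add, NNReal.coe_one]
  have h2 : dist (f s) (f t) ^ 2 ≤ (K * dist s t) ^ 2 :=
    pow_le_pow_left₀ dist_nonneg h 2
  have h3 : (0 : ℝ) ≤ K * dist s t ^ 2 := by positivity
  simp
  nlinarith

theorem PlaneDomain.arc_lt_top (Ω : PlaneDomain) :
    (μH[1] : Measure Plane) (frontier Ω.carrier) < ⊤ := by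
  have hcomp : IsCompact (frontier Ω.carrier) :=
    Metric.isCompact_of_isClosed_isBounded isClosed_frontier
      (Ω.bounded.closure.subset frontier_subset_closure)
  refine hcomp.induction_on (p := fun s => (μH[1] : Measure Plane) s < ⊤) (by simp)
    (fun s t hst ht => (measure_mono hst).trans_lt ht)
    (fun s t hs ht => (measure_union_le s t).trans_lt (ENNReal.add_lt_top.2 ⟨hs, ht⟩)) ?_
  intro x hx
  obtain ⟨T, f, K, r, hr, hf, hΩ⟩ := Ω.lipschitzBoundary x hx
  refine ⟨frontier Ω.carrier ∩ Metric.ball x r,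
    Filter.inter_mem self_mem_nhdsWithin (mem_nhdsWithin_of_mem_nhds (Metric.ball_mem_nhds x hr)), ?_⟩
  have hT0 : Continuous fun y : Plane => T y 0 :=
    (EuclideanSpace.proj (𝕜 := ℝ) (0 : Fin 2)).continuous.comp T.continuous
  have hT1 : Continuous fun y : Plane => T y 1 :=
    (EuclideanSpace.proj (𝕜 := ℝ) (1 : Fin 2)).continuous.comp T.continuous
  have hlip : LipschitzWith (1 * (1 + K)) (T.symm ∘ graphMap f) :=
    T.symm.isometry.lipschitz.comp (lipschitzWith_graphMap hf)
  have hsub : frontier Ω.carrier ∩ Metric.ball x r ⊆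
      (T.symm ∘ graphMap f) '' Icc (T x 0 - r) (T x 0 + r) := by
    rintro y ⟨hy, hyb⟩
    have hnot : y ∉ Ω.carrier := fun h => by
      rw [Ω.isOpen.frontier_eq] at hy
      exact hy.2 h
    have h1 : T y 1 ≤ f (T y 0) := not_lt.1 fun h => hnot ((hΩ y hyb).2 h)
    have h2 : f (T y 0) ≤ T y 1 := by
      by_contra! hlt
      have hop : IsOpen (Metric.ball x r ∩ {z : Plane | T z 1 < f (T z 0)}) :=
        Metric.isOpen_ball.inter (isOpen_lt hT1 (hf.continuous.comp hT0))
      obtain ⟨z, hz, hzΩ⟩ := mem_closure_iff.1 (frontier_subset_closure hy) _ hop ⟨hyb, hlt⟩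
      exact lt_asymm hz.2 ((hΩ z hz.1).1 hzΩ)
    refine ⟨T y 0, ?_, ?_⟩
    · have h3 : |T y 0 - T x 0| ≤ dist (T y) (T x) := by
        have := PiLp.norm_apply_le (T y - T x) (0 : Fin 2)
        simpa [dist_eq_norm] using this
      rw [T.isometry.dist_eq] at h3
      have h4 := abs_le.1 (h3.trans (Metric.mem_ball.1 hyb).le)
      constructor <;> linarith [h4.1, h4.2]
    · have : graphMap f (T y 0) = T y := by
        ext i
        fin_cases i
        · simp [graphMap]
        · simpa [graphMap] using le_antisymm h2 h1
      simp [this]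
  refine (measure_mono hsub).trans_lt ((hlip.hausdorffMeasure_image_le zero_le_one _).trans_lt ?_)
  rw [hausdorffMeasure_real, Real.volume_Icc]
  exact ENNReal.mul_lt_top (ENNReal.rpow_lt_top_of_nonneg zero_le_one ENNReal.coe_ne_top)
    ENNReal.ofReal_lt_top

instance (Ω : PlaneDomain) : IsFiniteMeasure Ω.arcMeasure :=
  ⟨by simpa using Ω.arc_lt_top⟩

instance (Ω : PlaneDomain) : IsFiniteMeasure Ω.areaMeasure :=
  ⟨by simpa using Ω.bounded.measure_lt_top⟩

/-- Triples `(u, G, g)`: a function and a vector field on `Ω`, and a function on `∂Ω`, all square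
integrable. -/
abbrev Triple (Ω : PlaneDomain) :=
  Lp ℝ 2 Ω.areaMeasure × Lp Plane 2 Ω.areaMeasure × Lp ℝ 2 Ω.arcMeasure

/-- `G` is the weak (distributional) gradient of `u` in `Ω`. -/
def IsWeakGradient (Ω : PlaneDomain) (u : Plane → ℝ) (G : Plane → Plane) : Prop :=
  ∀ φ : Plane → ℝ, ContDiff ℝ ∞ φ → HasCompactSupport φ → tsupport φ ⊆ Ω.carrier →
    ∫ x, u x • ∇ φ x ∂Ω.areaMeasure = -∫ x, φ x • G x ∂Ω.areaMeasure

/-- `g` is the boundary trace of the function `u` with weak gradient `G`: there are functions `φ`,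
smooth on the whole plane, that approximate `u` in the Sobolev norm on `Ω` while their restrictions
to `∂Ω` approximate `g` in the mean-square sense. -/
def IsTrace (Ω : PlaneDomain) (u : Plane → ℝ) (G : Plane → Plane) (g : Plane → ℝ) : Prop :=
  ∀ ε : ENNReal, 0 < ε → ∃ φ : Plane → ℝ, ContDiff ℝ ∞ φ ∧
    eLpNorm (fun x => u x - φ x) 2 Ω.areaMeasure ≤ ε ∧
    eLpNorm (fun x => G x - ∇ φ x) 2 Ω.areaMeasure ≤ ε ∧
    eLpNorm (fun x => g x - φ x) 2 Ω.arcMeasure ≤ ε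

theorem gradient_add_smooth {φ ψ : Plane → ℝ} (hφ : ContDiff ℝ ∞ φ) (hψ : ContDiff ℝ ∞ ψ)
    (x : Plane) : ∇ (fun y => φ y + ψ y) x = ∇ φ x + ∇ ψ x := by
  have h1 := (hφ.differentiable (by simp) x).hasFDerivAt
  have h2 := (hψ.differentiable (by simp) x).hasFDerivAt
  simp only [gradient]
  rw [(h1.fun_add h2).fderiv, map_add]

theorem gradient_smul_smooth {φ : Plane → ℝ} (hφ : ContDiff ℝ ∞ φ) (c : ℝ)
    (x : Plane) : ∇ (fun y => c * φ y) x = c • ∇ φ x := by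
  have h1 := (hφ.differentiable (by simp) x).hasFDerivAt
  simp only [gradient]
  rw [(h1.const_mul c).fderiv, map_smulₛₗ]
  simp

theorem continuous_gradient {φ : Plane → ℝ} (hφ : ContDiff ℝ ∞ φ) : Continuous (∇ φ) := by
  unfold gradient
  exact (LinearIsometryEquiv.continuous _).comp (hφ.continuous_fderiv (by simp))

theorem hasCompactSupport_gradient {φ : Plane → ℝ} (hφ : HasCompactSupport φ) :
    HasCompactSupport (∇ φ) := by
  have := (hφ.fderiv (𝕜 := ℝ)).comp_left (g := (InnerProductSpace.toDual ℝ Plane).symm) (map_zero _)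
  exact this

theorem integrable_smul_gradient {Ω : PlaneDomain} (u : Lp ℝ 2 Ω.areaMeasure) {φ : Plane → ℝ}
    (hφ : ContDiff ℝ ∞ φ) (hc : HasCompactSupport φ) :
    Integrable (fun x => u x • ∇ φ x) Ω.areaMeasure :=
  memLp_one_iff_integrable.1 <| MemLp.smul (p := 2) (q := 2) (r := 1)
    ((continuous_gradient hφ).memLp_of_hasCompactSupport (hasCompactSupport_gradient hc))
    (Lp.memLp u)

theorem integrable_smul_field {Ω : PlaneDomain} (G : Lp Plane 2 Ω.areaMeasure) {φ : Plane → ℝ}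
    (hφ : ContDiff ℝ ∞ φ) (hc : HasCompactSupport φ) :
    Integrable (fun x => φ x • G x) Ω.areaMeasure :=
  memLp_one_iff_integrable.1 <| MemLp.smul (p := 2) (q := 2) (r := 1) (Lp.memLp G)
    (hφ.continuous.memLp_of_hasCompactSupport hc)

/-- The Sobolev space `H¹(Ω)`. An element is recorded together with its weak gradient and its
boundary trace; both are determined by the function, since the boundary is Lipschitz. -/
def H1 (Ω : PlaneDomain) : Submodule ℝ (Triple Ω) where
  carrier := {p | IsWeakGradient Ω p.1 p.2.1 ∧ IsTrace Ω p.1 p.2.1 p.2.2}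
  zero_mem' := by
    constructor
    · intro φ _ _ _
      have h1 : (fun x => (0 : Lp ℝ 2 Ω.areaMeasure) x • ∇ φ x) =ᵐ[Ω.areaMeasure] 0 := by
        filter_upwards [Lp.coeFn_zero ℝ 2 Ω.areaMeasure] with x hx
        simp only [hx, Pi.zero_apply, zero_smul]
      have h2 : (fun x => φ x • (0 : Lp Plane 2 Ω.areaMeasure) x) =ᵐ[Ω.areaMeasure] 0 := by
        filter_upwards [Lp.coeFn_zero Plane 2 Ω.areaMeasure] with x hx
        simp only [hx, Pi.zero_apply, smul_zero]
      simp only [Prod.fst_zero, Prod.snd_zero]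
      rw [integral_congr_ae h1, integral_congr_ae h2]
      simp
    · intro ε _
      refine ⟨fun _ => 0, contDiff_const, ?_, ?_, ?_⟩
      · rw [eLpNorm_congr_ae (g := 0)]
        · simp
        · filter_upwards [Lp.coeFn_zero ℝ 2 Ω.areaMeasure] with x hx
          simp only [Prod.fst_zero, hx, Pi.zero_apply, sub_zero]
      · rw [eLpNorm_congr_ae (g := 0)]
        · simp
        · filter_upwards [Lp.coeFn_zero Plane 2 Ω.areaMeasure] with x hx
          simp only [Prod.fst_zero, Prod.snd_zero, hx, Pi.zero_apply, gradient_fun_const, sub_zero]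
      · rw [eLpNorm_congr_ae (g := 0)]
        · simp
        · filter_upwards [Lp.coeFn_zero ℝ 2 Ω.arcMeasure] with x hx
          simp only [Prod.snd_zero, hx, Pi.zero_apply, sub_zero]
  add_mem' := by
    rintro p q ⟨hp, hp'⟩ ⟨hq, hq'⟩
    constructor
    · intro φ hφ hc hs
      have h1 : (fun x => (p + q).1 x • ∇ φ x) =ᵐ[Ω.areaMeasure]
          fun x => p.1 x • ∇ φ x + q.1 x • ∇ φ x := by
        filter_upwards [Lp.coeFn_add p.1 q.1] with x hx
        simp only [Prod.fst_add, hx, Pi.add_apply, add_smul]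
      have h2 : (fun x => φ x • (p + q).2.1 x) =ᵐ[Ω.areaMeasure]
          fun x => φ x • p.2.1 x + φ x • q.2.1 x := by
        filter_upwards [Lp.coeFn_add p.2.1 q.2.1] with x hx
        simp only [Prod.fst_add, Prod.snd_add, hx, Pi.add_apply, smul_add]
      rw [integral_congr_ae h1, integral_congr_ae h2,
        integral_add (integrable_smul_gradient _ hφ hc) (integrable_smul_gradient _ hφ hc),
        integral_add (integrable_smul_field _ hφ hc) (integrable_smul_field _ hφ hc),
        hp φ hφ hc hs, hq φ hφ hc hs, neg_add]
    · intro ε hε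
      have hε2 : 0 < ε / 2 := ENNReal.half_pos hε.ne'
      obtain ⟨φ, hφ, a1, a2, a3⟩ := hp' _ hε2
      obtain ⟨ψ, hψ, b1, b2, b3⟩ := hq' _ hε2
      have key : ∀ a b : ENNReal, a ≤ ε / 2 → b ≤ ε / 2 → a + b ≤ ε := fun a b ha hb =>
        (add_le_add ha hb).trans (ENNReal.add_halves ε).le
      refine ⟨fun x => φ x + ψ x, hφ.add hψ, ?_, ?_, ?_⟩
      · refine le_trans ?_ (key _ _ a1 b1)
        rw [eLpNorm_congr_ae (g := (fun x => p.1 x - φ x) + fun x => q.1 x - ψ x)]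
        · exact eLpNorm_add_le ((Lp.aestronglyMeasurable _).sub hφ.continuous.aestronglyMeasurable)
            ((Lp.aestronglyMeasurable _).sub hψ.continuous.aestronglyMeasurable) (by norm_num)
        · filter_upwards [Lp.coeFn_add p.1 q.1] with x hx
          simp only [Prod.fst_add, hx, Pi.add_apply]
          ring
      · refine le_trans ?_ (key _ _ a2 b2)
        rw [eLpNorm_congr_ae (g := (fun x => p.2.1 x - ∇ φ x) + fun x => q.2.1 x - ∇ ψ x)]
        · exact eLpNorm_add_le
            ((Lp.aestronglyMeasurable _).sub (continuous_gradient hφ).aestronglyMeasurable)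
            ((Lp.aestronglyMeasurable _).sub (continuous_gradient hψ).aestronglyMeasurable)
            (by norm_num)
        · filter_upwards [Lp.coeFn_add p.2.1 q.2.1] with x hx
          simp only [Prod.snd_add, Prod.fst_add, hx, gradient_add_smooth hφ hψ, Pi.add_apply]
          abel
      · refine le_trans ?_ (key _ _ a3 b3)
        rw [eLpNorm_congr_ae (g := (fun x => p.2.2 x - φ x) + fun x => q.2.2 x - ψ x)]
        · exact eLpNorm_add_le ((Lp.aestronglyMeasurable _).sub hφ.continuous.aestronglyMeasurable)
            ((Lp.aestronglyMeasurable _).sub hψ.continuous.aestronglyMeasurable) (by norm_num)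
        · filter_upwards [Lp.coeFn_add p.2.2 q.2.2] with x hx
          simp only [Prod.snd_add, hx, Pi.add_apply]
          ring
  smul_mem' := by
    rintro c p ⟨hp, hp'⟩
    constructor
    · intro φ hφ hc hs
      have h1 : (fun x => (c • p).1 x • ∇ φ x) =ᵐ[Ω.areaMeasure]
          fun x => c • (p.1 x • ∇ φ x) := by
        filter_upwards [Lp.coeFn_smul c p.1] with x hx
        simp only [Prod.smul_fst, hx, Pi.smul_apply, smul_assoc]
      have h2 : (fun x => φ x • (c • p).2.1 x) =ᵐ[Ω.areaMeasure]
          fun x => c • (φ x • p.2.1 x) := by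
        filter_upwards [Lp.coeFn_smul c p.2.1] with x hx
        simp only [Prod.smul_fst, Prod.smul_snd, hx, Pi.smul_apply, smul_comm c]
      rw [integral_congr_ae h1, integral_congr_ae h2, integral_smul, integral_smul,
        hp φ hφ hc hs, smul_neg]
    · intro ε hε
      have hC : ‖c‖ₑ + 1 ≠ 0 := by simp
      have hC' : ‖c‖ₑ + 1 ≠ ⊤ := by simp
      obtain ⟨φ, hφ, a1, a2, a3⟩ := hp' (ε / (‖c‖ₑ + 1)) (ENNReal.div_pos hε.ne' hC')
      have key : ∀ a : ENNReal, a ≤ ε / (‖c‖ₑ + 1) → ‖c‖ₑ * a ≤ ε := fun a ha => by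
        calc ‖c‖ₑ * a ≤ (‖c‖ₑ + 1) * (ε / (‖c‖ₑ + 1)) := mul_le_mul' le_self_add ha
          _ = ε := ENNReal.mul_div_cancel hC hC'
      refine ⟨fun x => c * φ x, contDiff_const.mul hφ, ?_, ?_, ?_⟩
      · refine le_trans (le_of_eq ?_) (key _ a1)
        rw [← eLpNorm_const_smul]
        refine eLpNorm_congr_ae ?_
        filter_upwards [Lp.coeFn_smul c p.1] with x hx
        simp only [Prod.smul_fst, hx, Pi.smul_apply, smul_eq_mul]
        ring
      · refine le_trans (le_of_eq ?_) (key _ a2)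
        rw [← eLpNorm_const_smul]
        refine eLpNorm_congr_ae ?_
        filter_upwards [Lp.coeFn_smul c p.2.1] with x hx
        simp only [Prod.smul_snd, Prod.smul_fst, hx, gradient_smul_smooth hφ, Pi.smul_apply,
          smul_sub]
      · refine le_trans (le_of_eq ?_) (key _ a3)
        rw [← eLpNorm_const_smul]
        refine eLpNorm_congr_ae ?_
        filter_upwards [Lp.coeFn_smul c p.2.2] with x hx
        simp only [Prod.smul_snd, hx, Pi.smul_apply, smul_eq_mul]
        ring

theorem integral_gradient_eq_zero {φ : Plane → ℝ} (hφ : ContDiff ℝ ∞ φ)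
    (hc : HasCompactSupport φ) : ∫ x, ∇ φ x = 0 := by
  have hint : Integrable (∇ φ) :=
    (continuous_gradient hφ).integrable_of_hasCompactSupport (hasCompactSupport_gradient hc)
  refine ext_inner_right ℝ fun v => ?_
  have hi : ∀ x, ⟪∇ φ x, v⟫ = fderiv ℝ φ x v := fun x => inner_gradient_left
  have hf : Integrable fun x => fderiv ℝ φ x v := by
    simpa only [← hi] using hint.inner_const v
  have hzero : ∫ x, fderiv ℝ φ x v = 0 := by
    have h := integral_mul_fderiv_eq_neg_fderiv_mul_of_integrable (μ := (volume : Measure Plane))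
      (f := fun _ => (1 : ℝ)) (g := φ) (v := v) (by simp) (by simpa using hf)
      (by simpa using hφ.continuous.integrable_of_hasCompactSupport hc)
      (fun x _ => differentiableAt_const _) (fun x _ => hφ.differentiable (by simp) x)
    simpa using h
  rw [inner_zero_left, real_inner_comm, ← integral_inner hint]
  refine Eq.trans (integral_congr_ae (ae_of_all _ fun x => ?_)) hzero
  exact (real_inner_comm _ _).trans (hi x)

theorem const_mem_H1 (Ω : PlaneDomain) (c : ℝ) :
    (((memLp_const c).toLp (fun _ => c), 0, (memLp_const c).toLp (fun _ => c)) : Triple Ω) ∈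
      H1 Ω := by
  constructor
  · intro φ hφ hc hs
    have h1 : (fun x => (memLp_const c : MemLp (fun _ => c) 2 Ω.areaMeasure).toLp (fun _ => c) x •
        ∇ φ x) =ᵐ[Ω.areaMeasure] fun x => c • ∇ φ x := by
      filter_upwards [(memLp_const c : MemLp (fun _ => c) 2 Ω.areaMeasure).coeFn_toLp] with x hx
      rw [hx]
    have h2 : (fun x => φ x • (0 : Lp Plane 2 Ω.areaMeasure) x) =ᵐ[Ω.areaMeasure] 0 := by
      filter_upwards [Lp.coeFn_zero Plane 2 Ω.areaMeasure] with x hx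
      rw [hx, Pi.zero_apply, smul_zero]
    have h3 : ∫ x, ∇ φ x ∂Ω.areaMeasure = 0 := by
      rw [← integral_gradient_eq_zero hφ hc]
      refine setIntegral_eq_integral_of_forall_compl_eq_zero fun x hx => ?_
      have hx' : x ∉ tsupport φ := fun h => hx (hs h)
      rw [Filter.EventuallyEq.gradient_eq (notMem_tsupport_iff_eventuallyEq.1 hx')]
      exact gradient_fun_const x (0 : ℝ)
    simp only
    rw [integral_congr_ae h1, integral_congr_ae h2, integral_smul, h3]
    simp
  · intro ε _
    refine ⟨fun _ => c, contDiff_const, ?_, ?_, ?_⟩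
    · rw [eLpNorm_congr_ae (g := 0)]
      · simp
      · filter_upwards [(memLp_const c : MemLp (fun _ => c) 2 Ω.areaMeasure).coeFn_toLp] with x hx
        simp only [hx, Pi.zero_apply, sub_self]
    · rw [eLpNorm_congr_ae (g := 0)]
      · simp
      · filter_upwards [Lp.coeFn_zero Plane 2 Ω.areaMeasure] with x hx
        simp only [hx, Pi.zero_apply, gradient_fun_const, sub_zero]
    · rw [eLpNorm_congr_ae (g := 0)]
      · simp
      · filter_upwards [(memLp_const c : MemLp (fun _ => c) 2 Ω.arcMeasure).coeFn_toLp] with x hx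
        simp only [hx, Pi.zero_apply, sub_self]

namespace H1

/-- The constant function `c` on `Ω`. -/
def const (Ω : PlaneDomain) (c : ℝ) : H1 Ω := ⟨_, const_mem_H1 Ω c⟩

variable {Ω : PlaneDomain}

/-- The weak gradient `∇v`. -/
def grad (v : H1 Ω) : Plane → Plane := v.1.2.1

/-- The boundary values of `v`, in the sense of traces. -/
def trace (v : H1 Ω) : Plane → ℝ := v.1.2.2

/-- `∫_Ω v`. -/
def integral (v : H1 Ω) : ℝ := ∫ x in Ω.carrier, v.1.1 x

/-- `∫_Ω ∇v · ∇w`. -/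
def gradProd (v w : H1 Ω) : ℝ := ∫ x in Ω.carrier, ⟪grad v x, grad w x⟫

/-- `∫_∂Ω v`. -/
def bdryIntegral (v : H1 Ω) : ℝ := ∫ x in frontier Ω.carrier, trace v x ∂μH[1]

/-- `∫_∂Ω v w`. -/
def bdryProd (v w : H1 Ω) : ℝ := ∫ x in frontier Ω.carrier, trace v x * trace w x ∂μH[1]

/-- `v = 0` on `∂Ω`. -/
def VanishesOnBoundary (v : H1 Ω) : Prop := trace v =ᵐ[Ω.arcMeasure] 0

end H1

section

open H1

variable {Ω : PlaneDomain}

/-- `u₀` is a weak solution of `-Δu₀ = 1` in `Ω`, `u₀ = 0` on `∂Ω`. -/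
def SolvesP0 (u₀ : H1 Ω) : Prop :=
  VanishesOnBoundary u₀ ∧ ∀ w : H1 Ω, VanishesOnBoundary w → gradProd u₀ w = integral w

/-- `u` is a weak solution of `-Δu = 1` in `Ω`, `u + β ∂u/∂n = 0` on `∂Ω` (for `β > 0`). -/
def SolvesP (β : ℝ) (u : H1 Ω) : Prop :=
  ∀ w : H1 Ω, gradProd u w + (1 / β) * bdryProd u w = integral w

/-- `u` is a weak solution of `-Δu = 1` in `Ω`, `∂u/∂n = -|Ω|/|∂Ω|` on `∂Ω`, with `∫_∂Ω u = 0`. -/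
def SolvesPInfty (u : H1 Ω) : Prop :=
  bdryIntegral u = 0 ∧
    ∀ w : H1 Ω, gradProd u w + Ω.area / Ω.perimeter * bdryIntegral w = integral w

/-- `𝒜(v) = ∫_Ω (2v - |∇v|²)`. -/
def functionalA (v : H1 Ω) : ℝ := ∫ x in Ω.carrier, (2 * v.1.1 x - ‖grad v x‖ ^ 2)

/-- `ℬ(v) = ∫_∂Ω v²`. -/
def functionalB (v : H1 Ω) : ℝ := ∫ x in frontier Ω.carrier, trace v x ^ 2 ∂μH[1]

/-- The Robin functional `𝒥(v) = 𝒜(v) - ℬ(v)/β`. -/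
def functionalJ (β : ℝ) (v : H1 Ω) : ℝ := functionalA v - (1 / β) * functionalB v

/-- The rational function
`R(β) = Q₀ + β|Ω|²/|∂Ω| + β(Σ_∞ - Q₀)² / (β(Σ_∞ - Q₀) - Σ₁)`,
with arguments `m = |Ω|²/|∂Ω|`, `Sinf = Σ_∞`, `S1 = Σ₁` and `Q0`. -/
def lowerBoundR (m Sinf S1 Q0 β : ℝ) : ℝ :=
  Q0 + β * m + β * (Sinf - Q0) ^ 2 / (β * (Sinf - Q0) - S1)

end

end SlipFlow

end

noncomputable section

namespace SlipFlow

/-! ### Positivity of area and perimeter -/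

namespace PlaneDomain

variable (Ω : PlaneDomain)

/-! The Robin solution maximises the concave functional `𝒥_β`: by the weak equation, `Q(β) - 𝒥_β(v)`
is the energy `∫|∇(u_β - v)|² + (1/β)∫_∂Ω (u_β - v)²`, so each test function gives a lower bound for
`Q(β)` (`SolvesP.functionalJ_le`). The theorem evaluates the best bound from the span of `1`, `u₀`
and `u_∞`.

On that span the quadratic form is almost diagonal. Constants have no gradient, `u₀` has no trace,
and `u_∞` has boundary mean zero. On test functions with zero trace `u_∞` satisfies the same
equation as `u₀`, so `u_∞ - u₀` is gradient-orthogonal to `u₀`, with Dirichlet energy `D = Σ_∞ -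
Q₀`; hence `Q₀ ≤ Σ_∞`. In the coordinates `c`, `s + t` and `t` the functional separates
(`functionalJ_combination`), and completing the square in `t` (`quadratic_eq_lowerBoundR`) writes it
as `R(β)` minus three squares with weights `|∂Ω|/β`, `Q₀` and `(βD - Σ₁)/β`. The first two weights
are positive and the third is nonnegative, which yields the maximum, the constraints on maximisers
and their uniqueness. The remaining claims about `R` are calculus of one rational function, with the
case `D = Σ₁ = 0` apart. -/

theorem carrier_nonempty : Ω.carrier.Nonempty :=
  Ω.simplyConnected.isPathConnected.nonempty

theorem area_pos : 0 < Ω.area :=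
  ENNReal.toReal_pos (Ω.isOpen.measure_pos volume Ω.carrier_nonempty).ne'
    Ω.bounded.measure_lt_top.ne

/-- Every vertical line that meets a bounded domain meets its boundary. -/
theorem image_fst_subset_image_fst_frontier :
    (fun y : Plane => y 0) '' Ω.carrier ⊆ (fun y : Plane => y 0) '' frontier Ω.carrier := by
  rintro _ ⟨x, hx, rfl⟩
  let l : ℝ → Plane := fun s => !₂[x 0, s]
  have hl : Isometry l := Isometry.of_dist_eq fun s t => by
    simp [l, EuclideanSpace.dist_eq, Real.sqrt_sq_eq_abs, Real.dist_eq]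
  have hlx : l (x 1) = x := by
    ext i
    fin_cases i <;> simp [l]
  have hpre : Bornology.IsBounded (l ⁻¹' Ω.carrier) :=
    hl.antilipschitz.isBounded_preimage Ω.bounded
  have hne : (l ⁻¹' Ω.carrier).Nonempty := ⟨x 1, by simpa [hlx] using hx⟩
  -- The slice of the domain is nonempty and bounded, so it is not the whole line; since `ℝ` is
  -- connected, it has a frontier point.
  have huniv : l ⁻¹' Ω.carrier ≠ univ := fun h => by
    rw [h] at hpre
    exact NormedSpace.unbounded_univ ℝ ℝ hpre
  obtain ⟨s, hs⟩ := nonempty_frontier_iff.2 ⟨hne, huniv⟩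
  exact ⟨l s, hl.continuous.frontier_preimage_subset _ hs, by simp [l]⟩

/-- Projection to the first axis is 1-Lipschitz and cannot increase one-dimensional Hausdorff
measure. A null boundary would thus have a null shadow, but that shadow contains the nonempty open
shadow of the domain. -/
theorem perimeter_pos : 0 < Ω.perimeter := by
  refine ENNReal.toReal_pos (fun h0 => ?_) Ω.arc_lt_top.ne
  have hlip : LipschitzWith 1 fun y : Plane => y 0 := LipschitzWith.of_dist_le_mul fun y z => by
    have := PiLp.norm_apply_le (y - z) (0 : Fin 2)
    simpa [dist_eq_norm] using this
  have hzero : volume ((fun y : Plane => y 0) '' Ω.carrier) = 0 := by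
    refine measure_mono_null Ω.image_fst_subset_image_fst_frontier ?_
    rw [← hausdorffMeasure_real]
    have := hlip.hausdorffMeasure_image_le zero_le_one (frontier Ω.carrier)
    rw [h0, mul_zero] at this
    exact le_antisymm this zero_le
  have hopen : IsOpen ((fun y : Plane => y 0) '' Ω.carrier) := by
    have h := (EuclideanSpace.proj (𝕜 := ℝ) (0 : Fin 2) : Plane →L[ℝ] ℝ).isOpenMap
      (fun s => ⟨!₂[s, 0], by simp⟩) _ Ω.isOpen
    exact h
  exact (hopen.measure_pos volume (Ω.carrier_nonempty.image _)).ne' hzero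

end PlaneDomain

/-! ### Smooth functions as elements of `H¹(Ω)` -/

theorem gradient_mul_smooth {φ ψ : Plane → ℝ} (hφ : ContDiff ℝ ∞ φ) (hψ : ContDiff ℝ ∞ ψ)
    (x : Plane) : ∇ (fun y => φ y * ψ y) x = φ x • ∇ ψ x + ψ x • ∇ φ x := by
  have h1 := (hφ.differentiable (by simp) x).hasFDerivAt
  have h2 := (hψ.differentiable (by simp) x).hasFDerivAt
  simp only [gradient]
  rw [(h1.fun_mul h2).fderiv, map_add, map_smulₛₗ, map_smulₛₗ]
  simp

theorem gradient_eq_zero_of_notMem_tsupport {φ : Plane → ℝ} {x : Plane} (hx : x ∉ tsupport φ) :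
    ∇ φ x = 0 := by
  rw [Filter.EventuallyEq.gradient_eq (notMem_tsupport_iff_eventuallyEq.1 hx)]
  exact gradient_fun_const x (0 : ℝ)

/-- Since `ψ` is supported in `Ω`, both integrals extend to the plane, where they add up to the
integral of `∇(φψ)`, which is zero. -/
theorem isWeakGradient_gradient (Ω : PlaneDomain) {φ : Plane → ℝ} (hφ : ContDiff ℝ ∞ φ) :
    IsWeakGradient Ω φ (∇ φ) := by
  intro ψ hψ hc hs
  have hz : ∀ x ∉ Ω.carrier, ψ x = 0 ∧ ∇ ψ x = 0 := fun x hx =>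
    ⟨image_eq_zero_of_notMem_tsupport fun h => hx (hs h),
      gradient_eq_zero_of_notMem_tsupport fun h => hx (hs h)⟩
  rw [setIntegral_eq_integral_of_forall_compl_eq_zero fun x hx => by simp [(hz x hx).2],
    setIntegral_eq_integral_of_forall_compl_eq_zero fun x hx => by simp [(hz x hx).1],
    eq_neg_iff_add_eq_zero, ← integral_add]
  · rw [← integral_gradient_eq_zero (hφ.mul hψ) hc.mul_left]
    exact integral_congr_ae (ae_of_all _ fun x => (gradient_mul_smooth hφ hψ x).symm)
  · exact (hφ.continuous.smul (continuous_gradient hψ)).integrable_of_hasCompactSupport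
      (hasCompactSupport_gradient hc).smul_left
  · exact (hψ.continuous.smul (continuous_gradient hφ)).integrable_of_hasCompactSupport
      hc.smul_right

theorem IsWeakGradient.congr_ae {Ω : PlaneDomain} {u v : Plane → ℝ} {G H : Plane → Plane}
    (h : IsWeakGradient Ω u G) (huv : u =ᵐ[Ω.areaMeasure] v) (hGH : G =ᵐ[Ω.areaMeasure] H) :
    IsWeakGradient Ω v H := by
  intro φ hφ hc hs
  have h1 : (fun x => v x • ∇ φ x) =ᵐ[Ω.areaMeasure] fun x => u x • ∇ φ x := by
    filter_upwards [huv] with x hx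
    rw [hx]
  have h2 : (fun x => φ x • H x) =ᵐ[Ω.areaMeasure] fun x => φ x • G x := by
    filter_upwards [hGH] with x hx
    rw [hx]
  rw [integral_congr_ae h1, integral_congr_ae h2, h φ hφ hc hs]

theorem smooth_mem_H1 (Ω : PlaneDomain) {φ : Plane → ℝ} (hφ : ContDiff ℝ ∞ φ)
    (hc : HasCompactSupport φ) :
    (((hφ.continuous.memLp_of_hasCompactSupport hc).toLp φ,
      ((continuous_gradient hφ).memLp_of_hasCompactSupport
        (hasCompactSupport_gradient hc)).toLp (∇ φ),
      (hφ.continuous.memLp_of_hasCompactSupport hc).toLp φ) : Triple Ω) ∈ H1 Ω := by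
  have hΩ := (hφ.continuous.memLp_of_hasCompactSupport (μ := Ω.areaMeasure) (p := 2) hc).coeFn_toLp
  have hG := ((continuous_gradient hφ).memLp_of_hasCompactSupport (μ := Ω.areaMeasure) (p := 2)
    (hasCompactSupport_gradient hc)).coeFn_toLp
  have hb := (hφ.continuous.memLp_of_hasCompactSupport (μ := Ω.arcMeasure) (p := 2) hc).coeFn_toLp
  refine ⟨(isWeakGradient_gradient Ω hφ).congr_ae hΩ.symm hG.symm,
    fun ε _ => ⟨φ, hφ, ?_, ?_, ?_⟩⟩
  · refine (eLpNorm_congr_ae (g := 0) ?_).trans_le (by simp)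
    filter_upwards [hΩ] with x hx
    simp only [hx, Pi.zero_apply, sub_self]
  · refine (eLpNorm_congr_ae (g := 0) ?_).trans_le (by simp)
    filter_upwards [hG] with x hx
    simp only [hx, Pi.zero_apply, sub_self]
  · refine (eLpNorm_congr_ae (g := 0) ?_).trans_le (by simp)
    filter_upwards [hb] with x hx
    simp only [hx, Pi.zero_apply, sub_self]

namespace H1

variable {Ω : PlaneDomain}

/-- A compactly supported smooth function, as an element of `H¹(Ω)`. -/
def ofSmooth (Ω : PlaneDomain) {φ : Plane → ℝ} (hφ : ContDiff ℝ ∞ φ)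
    (hc : HasCompactSupport φ) : H1 Ω :=
  ⟨_, smooth_mem_H1 Ω hφ hc⟩

theorem integral_ofSmooth {φ : Plane → ℝ} (hφ : ContDiff ℝ ∞ φ) (hc : HasCompactSupport φ) :
    integral (ofSmooth Ω hφ hc) = ∫ x in Ω.carrier, φ x :=
  integral_congr_ae (hφ.continuous.memLp_of_hasCompactSupport hc).coeFn_toLp

theorem vanishesOnBoundary_ofSmooth {φ : Plane → ℝ} (hφ : ContDiff ℝ ∞ φ)
    (hc : HasCompactSupport φ) (hs : tsupport φ ⊆ Ω.carrier) :
    VanishesOnBoundary (ofSmooth Ω hφ hc) := by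
  have h : trace (ofSmooth Ω hφ hc) =ᵐ[Ω.arcMeasure] φ :=
    (hφ.continuous.memLp_of_hasCompactSupport hc).coeFn_toLp
  refine h.trans ?_
  filter_upwards [ae_restrict_mem isClosed_frontier.measurableSet] with x hx
  rw [Ω.isOpen.frontier_eq] at hx
  exact image_eq_zero_of_notMem_tsupport fun h => hx.2 (hs h)

/-- There is a test function vanishing on the boundary with positive integral. -/
theorem exists_vanishesOnBoundary_integral_pos (Ω : PlaneDomain) :
    ∃ w : H1 Ω, VanishesOnBoundary w ∧ 0 < integral w := by
  obtain ⟨x, hx⟩ := Ω.carrier_nonempty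
  obtain ⟨r, hr, hball⟩ := Metric.isOpen_iff.1 Ω.isOpen x hx
  -- The outer radius `r / 2` keeps the closed support inside the open ball of radius `r`.
  let b : ContDiffBump x := ⟨r / 4, r / 2, by positivity, by linarith⟩
  have hs : tsupport b ⊆ Ω.carrier := by
    rw [b.tsupport_eq]
    exact (Metric.closedBall_subset_ball (by simp only [b]; linarith)).trans hball
  refine ⟨ofSmooth Ω b.contDiff b.hasCompactSupport, vanishesOnBoundary_ofSmooth _ _ hs, ?_⟩
  rw [integral_ofSmooth, setIntegral_eq_integral_of_forall_compl_eq_zero fun y hy =>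
    image_eq_zero_of_notMem_tsupport fun h => hy (hs h)]
  exact b.integral_pos

/-! ### Bilinear forms on `H¹(Ω)` -/

theorem coeFn_const (c : ℝ) : (const Ω c).1.1 =ᵐ[Ω.areaMeasure] fun _ => c :=
  (memLp_const c).coeFn_toLp

theorem trace_const (c : ℝ) : trace (const Ω c) =ᵐ[Ω.arcMeasure] fun _ => c :=
  (memLp_const c).coeFn_toLp

/-- Bilinearity, symmetry and positivity are inherited from `L²` through this identity, without
integrability arguments. -/
theorem gradProd_eq_inner (v w : H1 Ω) : gradProd v w = ⟪v.1.2.1, w.1.2.1⟫ :=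
  (L2.inner_def _ _).symm

theorem bdryProd_eq_inner (v w : H1 Ω) : bdryProd v w = ⟪v.1.2.2, w.1.2.2⟫ := by
  rw [L2.inner_def]
  exact integral_congr_ae (ae_of_all _ fun x => mul_comm _ _)

theorem integral_eq_inner (v : H1 Ω) : integral v = ⟪(const Ω 1).1.1, v.1.1⟫ := by
  rw [L2.inner_def]
  refine integral_congr_ae ?_
  filter_upwards [coeFn_const (Ω := Ω) 1] with x hx
  rw [hx]
  simp

theorem gradProd_comm (v w : H1 Ω) : gradProd v w = gradProd w v := by
  simp only [gradProd_eq_inner, real_inner_comm]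

theorem bdryProd_comm (v w : H1 Ω) : bdryProd v w = bdryProd w v := by
  simp only [bdryProd_eq_inner, real_inner_comm]

theorem gradProd_self_nonneg (v : H1 Ω) : 0 ≤ gradProd v v := by
  rw [gradProd_eq_inner]
  exact real_inner_self_nonneg

theorem bdryProd_self_nonneg (v : H1 Ω) : 0 ≤ bdryProd v v := by
  rw [bdryProd_eq_inner]
  exact real_inner_self_nonneg

theorem gradProd_add_left (u v w : H1 Ω) : gradProd (u + v) w = gradProd u w + gradProd v w := by
  simp only [gradProd_eq_inner]
  exact inner_add_left _ _ _

theorem gradProd_smul_left (c : ℝ) (v w : H1 Ω) : gradProd (c • v) w = c * gradProd v w := by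
  simp only [gradProd_eq_inner]
  exact real_inner_smul_left _ _ _

theorem gradProd_add_right (u v w : H1 Ω) : gradProd u (v + w) = gradProd u v + gradProd u w := by
  simp only [gradProd_comm u, gradProd_add_left]

theorem gradProd_smul_right (c : ℝ) (v w : H1 Ω) : gradProd v (c • w) = c * gradProd v w := by
  simp only [gradProd_comm v, gradProd_smul_left]

theorem bdryProd_add_left (u v w : H1 Ω) : bdryProd (u + v) w = bdryProd u w + bdryProd v w := by
  simp only [bdryProd_eq_inner]
  exact inner_add_left _ _ _

theorem bdryProd_smul_left (c : ℝ) (v w : H1 Ω) : bdryProd (c • v) w = c * bdryProd v w := by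
  simp only [bdryProd_eq_inner]
  exact real_inner_smul_left _ _ _

theorem bdryProd_add_right (u v w : H1 Ω) : bdryProd u (v + w) = bdryProd u v + bdryProd u w := by
  simp only [bdryProd_comm u, bdryProd_add_left]

theorem bdryProd_smul_right (c : ℝ) (v w : H1 Ω) : bdryProd v (c • w) = c * bdryProd v w := by
  simp only [bdryProd_comm v, bdryProd_smul_left]

theorem integral_add (v w : H1 Ω) : integral (v + w) = integral v + integral w := by
  simp only [integral_eq_inner]
  exact inner_add_right _ _ _

theorem integral_smul (c : ℝ) (v : H1 Ω) : integral (c • v) = c * integral v := by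
  simp only [integral_eq_inner]
  exact real_inner_smul_right _ _ _

theorem integral_const (c : ℝ) : integral (const Ω c) = c * Ω.area := by
  have h : integral (const Ω c) = ∫ _ in Ω.carrier, c := integral_congr_ae (coeFn_const c)
  rw [h, setIntegral_const, smul_eq_mul, mul_comm]
  rfl

theorem bdryProd_const (c : ℝ) (v : H1 Ω) : bdryProd (const Ω c) v = c * bdryIntegral v := by
  refine (integral_congr_ae ?_).trans (integral_const_mul c _)
  filter_upwards [trace_const (Ω := Ω) c] with x hx
  rw [hx]

theorem bdryIntegral_const (c : ℝ) : bdryIntegral (const Ω c) = c * Ω.perimeter := by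
  have h : bdryIntegral (const Ω c) = ∫ _ in frontier Ω.carrier, c ∂μH[1] :=
    integral_congr_ae (trace_const c)
  rw [h, setIntegral_const, smul_eq_mul, mul_comm]
  rfl

theorem gradProd_const (c : ℝ) (v : H1 Ω) : gradProd (const Ω c) v = 0 := by
  rw [gradProd_eq_inner]
  exact inner_zero_left _

theorem gradProd_eq_zero_of_self {v : H1 Ω} (h : gradProd v v = 0) (w : H1 Ω) :
    gradProd v w = 0 := by
  rw [gradProd_eq_inner, inner_self_eq_zero] at h
  rw [gradProd_eq_inner, h, inner_zero_left]

theorem bdryProd_eq_zero_of_self {v : H1 Ω} (h : bdryProd v v = 0) (w : H1 Ω) :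
    bdryProd v w = 0 := by
  rw [bdryProd_eq_inner, inner_self_eq_zero] at h
  rw [bdryProd_eq_inner, h, inner_zero_left]

theorem VanishesOnBoundary.bdryProd {v : H1 Ω} (h : VanishesOnBoundary v) (w : H1 Ω) :
    bdryProd v w = 0 := by
  refine integral_eq_zero_of_ae ?_
  filter_upwards [h] with x hx
  simp [hx]

theorem VanishesOnBoundary.bdryIntegral {v : H1 Ω} (h : VanishesOnBoundary v) :
    bdryIntegral v = 0 :=
  integral_eq_zero_of_ae h

end H1

open H1

/-! ### The variational problems -/

section

variable {Ω : PlaneDomain}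

theorem functionalA_eq (v : H1 Ω) : functionalA v = 2 * integral v - gradProd v v := by
  have h1 : Integrable (fun x => v.1.1 x) Ω.areaMeasure :=
    (Lp.memLp v.1.1).integrable (by norm_num)
  have h2 : Integrable (fun x => ⟪grad v x, grad v x⟫) Ω.areaMeasure :=
    L2.integrable_inner (𝕜 := ℝ) v.1.2.1 v.1.2.1
  unfold functionalA H1.integral gradProd
  rw [← integral_const_mul, ← integral_sub (h1.const_mul 2) h2]
  simp only [real_inner_self_eq_norm_sq]

theorem functionalB_eq (v : H1 Ω) : functionalB v = bdryProd v v := by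
  simp only [functionalB, bdryProd, sq]

theorem functionalB_nonneg (v : H1 Ω) : 0 ≤ functionalB v := by
  rw [functionalB_eq]
  exact bdryProd_self_nonneg v

theorem functionalJ_eq (β : ℝ) (v : H1 Ω) :
    functionalJ β v = 2 * integral v - gradProd v v - 1 / β * bdryProd v v := by
  rw [functionalJ, functionalA_eq, functionalB_eq]

theorem SolvesP.functionalJ_self {β : ℝ} {u : H1 Ω} (hu : SolvesP β u) :
    functionalJ β u = integral u := by
  rw [functionalJ_eq]
  linarith [hu u]

/-- The solution of the Robin problem maximises the Robin functional. -/
theorem SolvesP.functionalJ_le {β : ℝ} (hβ : 0 < β) {u : H1 Ω} (hu : SolvesP β u) (v : H1 Ω) :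
    functionalJ β v ≤ integral u := by
  -- These two terms add up to `Q(β) - 𝒥_β(v)`, by the weak equation tested with `u` and with `v`.
  have hw : 0 ≤ gradProd (u + (-1 : ℝ) • v) (u + (-1 : ℝ) • v) := gradProd_self_nonneg _
  have hb : 0 ≤ 1 / β * bdryProd (u + (-1 : ℝ) • v) (u + (-1 : ℝ) • v) :=
    mul_nonneg (by positivity) (bdryProd_self_nonneg _)
  simp only [gradProd_add_left, gradProd_add_right, gradProd_smul_left, gradProd_smul_right,
    gradProd_comm v u] at hw
  simp only [bdryProd_add_left, bdryProd_add_right, bdryProd_smul_left, bdryProd_smul_right,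
    bdryProd_comm v u] at hb
  rw [functionalJ_eq]
  linarith [hu u, hu v]

/-- With zero trace, testing the equation with the constant `1` would give `0 = |Ω|`. -/
theorem SolvesP.functionalB_pos {β : ℝ} {u : H1 Ω} (hu : SolvesP β u) : 0 < functionalB u := by
  refine (functionalB_nonneg u).lt_of_ne' fun h => ?_
  rw [functionalB_eq] at h
  have h1 := hu (H1.const Ω 1)
  rw [bdryProd_eq_zero_of_self h, gradProd_comm, gradProd_const, H1.integral_const] at h1
  linarith [Ω.area_pos]

/-- Use `u_a` as a test function at `b > a`: `𝒥_b(u_a) = Q(a) + (1/a - 1/b) ℬ(u_a) > Q(a)`. -/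
theorem strictMonoOn_integral_of_solvesP {u : ℝ → H1 Ω} (hu : ∀ β : ℝ, 0 < β → SolvesP β (u β)) :
    StrictMonoOn (fun β => integral (u β)) (Ioi 0) := by
  intro a ha b hb hab
  have h1 := (hu b hb).functionalJ_le hb (u a)
  have h2 := (hu a ha).functionalJ_self
  have h3 : 0 < (1 / a - 1 / b) * functionalB (u a) :=
    mul_pos (sub_pos.2 (one_div_lt_one_div_of_lt ha hab)) (hu a ha).functionalB_pos
  unfold functionalJ at h1 h2
  simp only
  linarith

theorem SolvesP0.gradProd_self {u : H1 Ω} (hu : SolvesP0 u) : gradProd u u = integral u :=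
  hu.2 u hu.1

/-- `Q₀` is the Dirichlet energy of `u₀`. Were it zero, `∇u₀` would vanish, and testing with a bump
of positive integral gives a contradiction. -/
theorem SolvesP0.integral_pos {u : H1 Ω} (hu : SolvesP0 u) : 0 < integral u := by
  refine (hu.gradProd_self ▸ gradProd_self_nonneg u).lt_of_ne' fun h => ?_
  obtain ⟨w, hw, hpos⟩ := exists_vanishesOnBoundary_integral_pos Ω
  rw [← hu.2 w hw, gradProd_eq_zero_of_self (hu.gradProd_self.trans h)] at hpos
  exact hpos.false

theorem SolvesPInfty.gradProd_self {u : H1 Ω} (hu : SolvesPInfty u) :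
    gradProd u u = integral u := by
  simpa [hu.1] using hu.2 u

theorem SolvesPInfty.gradProd_of_vanishesOnBoundary {u w : H1 Ω} (hu : SolvesPInfty u)
    (hw : VanishesOnBoundary w) : gradProd u w = integral w := by
  simpa [hw.bdryIntegral] using hu.2 w

/-- The difference of the two integrals is the Dirichlet energy of `u_∞ - u₀`, because the cross
term `∫∇u_∞·∇u₀` equals `Q₀`. -/
theorem SolvesP0.integral_le {u₀ uInf : H1 Ω} (h₀ : SolvesP0 u₀) (hInf : SolvesPInfty uInf) :
    integral u₀ ≤ integral uInf := by
  have h := gradProd_self_nonneg (uInf + (-1 : ℝ) • u₀)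
  simp only [gradProd_add_left, gradProd_add_right, gradProd_smul_left, gradProd_smul_right,
    gradProd_comm u₀ uInf, hInf.gradProd_of_vanishesOnBoundary h₀.1, h₀.gradProd_self,
    hInf.gradProd_self] at h
  linarith

/-- The Robin functional on the span of `1`, `u₀` and `u_∞`, as a sum of squares. -/
theorem functionalJ_combination {u₀ uInf : H1 Ω} (h₀ : SolvesP0 u₀) (hInf : SolvesPInfty uInf)
    {β : ℝ} (hβ : 0 < β) (c s t : ℝ) :
    functionalJ β (H1.const Ω c + s • u₀ + t • uInf) =
      β * (Ω.area ^ 2 / Ω.perimeter) -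
          Ω.perimeter / β * (c - β * (Ω.area / Ω.perimeter)) ^ 2 +
        (integral u₀ - integral u₀ * (s + t - 1) ^ 2) +
        (2 * t * (integral uInf - integral u₀) -
          t ^ 2 * ((integral uInf - integral u₀) + functionalB uInf / β)) := by
  have hP := Ω.perimeter_pos.ne'
  have e1 : bdryProd uInf u₀ = 0 := by rw [bdryProd_comm, h₀.1.bdryProd]
  have e2 : bdryProd uInf (H1.const Ω c) = 0 := by
    rw [bdryProd_comm, bdryProd_const, hInf.1, mul_zero]
  have e3 : gradProd u₀ (H1.const Ω c) = 0 := by rw [gradProd_comm, gradProd_const]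
  have e4 : gradProd uInf (H1.const Ω c) = 0 := by rw [gradProd_comm, gradProd_const]
  -- The gradient energy becomes `s²Q₀ + 2stQ₀ + t²Σ_∞ = (s+t)²Q₀ + t²(Σ_∞ - Q₀)`, and the boundary
  -- energy `c²|∂Ω| + t²ℬ(u_∞)`.
  rw [functionalJ_eq, functionalB_eq]
  simp only [gradProd_add_left, gradProd_add_right, gradProd_smul_left, gradProd_smul_right,
    bdryProd_add_left, bdryProd_add_right, bdryProd_smul_left, bdryProd_smul_right,
    H1.integral_add, H1.integral_smul, H1.integral_const, gradProd_const, bdryProd_const,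
    bdryIntegral_const, h₀.1.bdryIntegral, hInf.1, h₀.1.bdryProd,
    gradProd_comm u₀ uInf, hInf.gradProd_of_vanishesOnBoundary h₀.1, h₀.gradProd_self,
    hInf.gradProd_self, e1, e2, e3, e4]
  field_simp
  ring

end

/-! ### Algebra and calculus of the rational function `R` -/

section

variable {m Sinf S1 Q0 β : ℝ}

/-- The case distinction behind the convention that a fraction with zero denominator is zero. -/
theorem denominator_pos_or_degenerate (hD : Q0 ≤ Sinf) (hS : S1 ≤ 0) :
    (Sinf = Q0 ∧ S1 = 0) ∨ ∀ β : ℝ, 0 < β → 0 < β * (Sinf - Q0) - S1 := by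
  rcases hD.lt_or_eq with h | h
  · exact Or.inr fun β hβ => by nlinarith [mul_pos hβ (sub_pos.2 h)]
  · rcases hS.lt_or_eq with h' | h'
    · exact Or.inr fun β _ => by subst h; linarith
    · exact Or.inl ⟨h.symm, h'⟩

/-- With `D = Sinf - Q0`, dividing twice gives `βD²/(βD - S1) = D + S1/β + S1²/(β(βD - S1))`. -/
theorem lowerBoundR_eq (hD : Q0 ≤ Sinf) (hS : S1 ≤ 0) (hβ : 0 < β) :
    lowerBoundR m Sinf S1 Q0 β =
      (β * m + Sinf + S1 / β) + S1 ^ 2 / (β ^ 2 * (Sinf - Q0) - β * S1) := by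
  unfold lowerBoundR
  rcases denominator_pos_or_degenerate hD hS with ⟨rfl, rfl⟩ | h
  · simp; ring
  · have h1 := (h β hβ).ne'
    rw [show β ^ 2 * (Sinf - Q0) - β * S1 = β * (β * (Sinf - Q0) - S1) by ring]
    field_simp
    ring

/-- The quadratic function of `t_∞` in the Robin functional, with the square completed. -/
theorem quadratic_eq_lowerBoundR (hD : Q0 ≤ Sinf) (hS : S1 ≤ 0) (hβ : 0 < β) (t : ℝ) :
    Q0 + β * m + (2 * t * (Sinf - Q0) - t ^ 2 * ((Sinf - Q0) + -S1 / β)) =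
      lowerBoundR m Sinf S1 Q0 β - (β * (Sinf - Q0) - S1) / β *
        (t - β * (Sinf - Q0) / (β * (Sinf - Q0) - S1)) ^ 2 := by
  unfold lowerBoundR
  rcases denominator_pos_or_degenerate hD hS with ⟨rfl, rfl⟩ | h
  -- Here the weight of the square vanishes, so the value `0` assigned to its undefined centre is
  -- immaterial.
  · simp
  · have h1 := (h β hβ).ne'
    field_simp
    ring

/-- In the quotient rule the terms cubic in `Sinf - Q0` cancel. -/
theorem hasDerivAt_lowerBoundR (h : β * (Sinf - Q0) - S1 ≠ 0) :
    HasDerivAt (lowerBoundR m Sinf S1 Q0)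
      (m - S1 * (Sinf - Q0) ^ 2 / (β * (Sinf - Q0) - S1) ^ 2) β := by
  have hd : HasDerivAt (fun b : ℝ => b * (Sinf - Q0) - S1) (Sinf - Q0) β := by
    simpa using ((hasDerivAt_id β).mul_const (Sinf - Q0)).sub_const S1
  have hn : HasDerivAt (fun b : ℝ => b * (Sinf - Q0) ^ 2) ((Sinf - Q0) ^ 2) β := by
    simpa using (hasDerivAt_id β).mul_const ((Sinf - Q0) ^ 2)
  have hl : HasDerivAt (fun b : ℝ => Q0 + b * m) m β := by
    simpa using ((hasDerivAt_id β).mul_const m).const_add Q0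
  refine (hl.fun_add (hn.fun_div hd h)).congr_deriv ?_
  field_simp
  ring

theorem lowerBoundR_degenerate : lowerBoundR m Q0 0 Q0 = fun β => Q0 + β * m := by
  funext β
  simp [lowerBoundR]

/-- The derivative of `R`; the fraction is read as zero in the degenerate case. -/
theorem hasDerivAt_lowerBoundR_of_pos (hD : Q0 ≤ Sinf) (hS : S1 ≤ 0) (hβ : 0 < β) :
    HasDerivAt (lowerBoundR m Sinf S1 Q0)
      (m - S1 * (Sinf - Q0) ^ 2 / (β * (Sinf - Q0) - S1) ^ 2) β := by
  rcases denominator_pos_or_degenerate hD hS with ⟨rfl, rfl⟩ | h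
  · rw [lowerBoundR_degenerate]
    simpa using ((hasDerivAt_id β).mul_const m).const_add Sinf
  · exact hasDerivAt_lowerBoundR (h β hβ).ne'

theorem hasDerivAt_deriv_lowerBoundR (hD : Q0 ≤ Sinf) (hS : S1 ≤ 0) (hβ : 0 < β) :
    HasDerivAt (deriv (lowerBoundR m Sinf S1 Q0))
      (2 * S1 * (Sinf - Q0) ^ 3 / (β * (Sinf - Q0) - S1) ^ 3) β := by
  -- The formula for the first derivative is established only on `(0, ∞)`, a neighbourhood of `β`.
  have heq : deriv (lowerBoundR m Sinf S1 Q0) =ᶠ[nhds β]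
      fun b => m - S1 * (Sinf - Q0) ^ 2 / (b * (Sinf - Q0) - S1) ^ 2 := by
    filter_upwards [Ioi_mem_nhds hβ] with b hb
    exact (hasDerivAt_lowerBoundR_of_pos hD hS hb).deriv
  refine HasDerivAt.congr_of_eventuallyEq ?_ heq
  rcases denominator_pos_or_degenerate hD hS with ⟨rfl, rfl⟩ | h
  · simpa using hasDerivAt_const β m
  · have h1 := (h β hβ).ne'
    have hd : HasDerivAt (fun b : ℝ => b * (Sinf - Q0) - S1) (Sinf - Q0) β := by
      simpa using ((hasDerivAt_id β).mul_const (Sinf - Q0)).sub_const S1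
    refine (((hasDerivAt_const β (S1 * (Sinf - Q0) ^ 2)).fun_div (hd.fun_pow 2)
      (pow_ne_zero 2 h1)).const_sub m).congr_deriv ?_
    field_simp
    ring

/-- As `S1 ≤ 0`, the derivative is at least `m`. -/
theorem strictMonoOn_lowerBoundR (hD : Q0 ≤ Sinf) (hS : S1 ≤ 0) (hm : 0 < m) :
    StrictMonoOn (lowerBoundR m Sinf S1 Q0) (Ioi 0) := by
  refine strictMonoOn_of_deriv_pos (convex_Ioi 0)
    (fun β hβ => (hasDerivAt_lowerBoundR_of_pos hD hS hβ).continuousAt.continuousWithinAt)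
    fun β hβ => ?_
  rw [interior_Ioi] at hβ
  rw [(hasDerivAt_lowerBoundR_of_pos hD hS hβ).deriv]
  have : S1 * (Sinf - Q0) ^ 2 / (β * (Sinf - Q0) - S1) ^ 2 ≤ 0 :=
    div_nonpos_of_nonpos_of_nonneg (mul_nonpos_of_nonpos_of_nonneg hS (sq_nonneg _)) (sq_nonneg _)
  linarith

theorem concaveOn_lowerBoundR (hD : Q0 ≤ Sinf) (hS : S1 ≤ 0) :
    ConcaveOn ℝ (Ioi 0) (lowerBoundR m Sinf S1 Q0) := by
  refine concaveOn_of_deriv2_nonpos' (convex_Ioi 0)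
    (fun β hβ => (hasDerivAt_lowerBoundR_of_pos hD hS hβ).differentiableAt.differentiableWithinAt)
    (fun β hβ => (hasDerivAt_deriv_lowerBoundR hD hS hβ).differentiableAt.differentiableWithinAt)
    fun β hβ => ?_
  have h := (hasDerivAt_deriv_lowerBoundR (m := m) hD hS hβ).deriv
  simp only [Function.iterate_succ, Function.iterate_zero, Function.comp_apply, id]
  rw [h]
  have h0 : 0 ≤ Sinf - Q0 := sub_nonneg.2 hD
  refine div_nonpos_of_nonpos_of_nonneg (mul_nonpos_of_nonpos_of_nonneg (by linarith)
    (pow_nonneg h0 3)) (pow_nonneg ?_ 3)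
  linarith [mul_nonneg (le_of_lt hβ) h0]

theorem add_mul_le_lowerBoundR (hD : Q0 ≤ Sinf) (hS : S1 ≤ 0) (hβ : 0 < β) :
    Q0 + β * m ≤ lowerBoundR m Sinf S1 Q0 β := by
  have h := mul_nonneg hβ.le (sub_nonneg.2 hD)
  have : 0 ≤ β * (Sinf - Q0) ^ 2 / (β * (Sinf - Q0) - S1) :=
    div_nonneg (mul_nonneg hβ.le (sq_nonneg _)) (by linarith)
  unfold lowerBoundR
  linarith

theorem add_mul_lt_lowerBoundR (hD : Q0 < Sinf) (hS : S1 ≤ 0) (hβ : 0 < β) :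
    Q0 + β * m < lowerBoundR m Sinf S1 Q0 β := by
  have h := mul_pos hβ (sub_pos.2 hD)
  have : 0 < β * (Sinf - Q0) ^ 2 / (β * (Sinf - Q0) - S1) :=
    div_pos (mul_pos hβ (pow_pos (sub_pos.2 hD) 2)) (by linarith)
  unfold lowerBoundR
  linarith

theorem expansion_le_lowerBoundR (hD : Q0 ≤ Sinf) (hS : S1 ≤ 0) (hβ : 0 < β) :
    β * m + Sinf + S1 / β ≤ lowerBoundR m Sinf S1 Q0 β := by
  rw [lowerBoundR_eq hD hS hβ]
  have h1 := mul_nonneg (sq_nonneg β) (sub_nonneg.2 hD)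
  have h2 := mul_nonneg hβ.le (neg_nonneg.2 hS)
  have : 0 ≤ S1 ^ 2 / (β ^ 2 * (Sinf - Q0) - β * S1) := div_nonneg (sq_nonneg _) (by linarith)
  linarith

theorem expansion_lt_lowerBoundR (hD : Q0 ≤ Sinf) (hS : S1 < 0) (hβ : 0 < β) :
    β * m + Sinf + S1 / β < lowerBoundR m Sinf S1 Q0 β := by
  rw [lowerBoundR_eq hD hS.le hβ]
  have h1 := mul_nonneg (sq_nonneg β) (sub_nonneg.2 hD)
  have h2 := mul_pos hβ (neg_pos.2 hS)
  have : 0 < S1 ^ 2 / (β ^ 2 * (Sinf - Q0) - β * S1) :=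
    div_pos (pow_pos (neg_pos.2 hS) 2 |>.trans_eq (by ring)) (by linarith)
  linarith

end

end SlipFlow

end

/-! ### The bound and its optimality -/

theorem mainTheorem1 (Ω : SlipFlow.PlaneDomain) (u₀ uInf : SlipFlow.H1 Ω) (u : ℝ → SlipFlow.H1 Ω)
    (h₀ : SlipFlow.SolvesP0 u₀) (hInf : SlipFlow.SolvesPInfty uInf)
    (hu : ∀ β : ℝ, 0 < β → SlipFlow.SolvesP β (u β))
    (Q₀ SInf S₁ m : ℝ) (Q R : ℝ → ℝ)
    (hQ₀ : Q₀ = SlipFlow.H1.integral u₀)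
    (hSInf : SInf = SlipFlow.H1.integral uInf)
    (hS₁ : S₁ = -SlipFlow.functionalB uInf)
    (hm : m = Ω.area ^ 2 / Ω.perimeter)
    (hQ : ∀ β, Q β = SlipFlow.H1.integral (u β))
    (hR : ∀ β, R β = SlipFlow.lowerBoundR m SInf S₁ Q₀ β) :
    -- signs of the functionals
    0 < Ω.area ∧ 0 < Ω.perimeter ∧ 0 < Q₀ ∧ Q₀ ≤ SInf ∧ S₁ ≤ 0 ∧
    (∀ β : ℝ, 0 < β →
      -- the lower bound
      R β ≤ Q β ∧
      -- it is the maximum of the Robin functional over the test functions c₀ + t₀ u₀ + t_∞ u_∞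
      IsGreatest (Set.range fun p : ℝ × ℝ × ℝ => SlipFlow.functionalJ β
        (SlipFlow.H1.const Ω p.1 + p.2.1 • u₀ + p.2.2 • uInf)) (R β) ∧
      -- every maximising triple has c₀ = β|Ω|/|∂Ω| and t₀ + t_∞ = 1
      (∀ c t₀ tInf : ℝ, SlipFlow.functionalJ β
          (SlipFlow.H1.const Ω c + t₀ • u₀ + tInf • uInf) = R β →
        c = β * (Ω.area / Ω.perimeter) ∧ t₀ + tInf = 1) ∧
      -- the maximising triple is unique when the denominator in `R` does not vanish
      (β * (SInf - Q₀) - S₁ ≠ 0 →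
        ∃! p : ℝ × ℝ × ℝ, SlipFlow.functionalJ β
          (SlipFlow.H1.const Ω p.1 + p.2.1 • u₀ + p.2.2 • uInf) = R β) ∧
      -- the form of `R` suited to large β
      R β = (β * m + SInf + S₁ / β) + S₁ ^ 2 / (β ^ 2 * (SInf - Q₀) - β * S₁) ∧
      -- improvement on the two older lower bounds, strict outside the degenerate cases
      Q₀ + β * m ≤ R β ∧ (SInf ≠ Q₀ → Q₀ + β * m < R β) ∧
      β * m + SInf + S₁ / β ≤ R β ∧ (S₁ ≠ 0 → β * m + SInf + S₁ / β < R β) ∧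
      -- the second derivative
      DifferentiableAt ℝ R β ∧
      HasDerivAt (deriv R) (2 * S₁ * (SInf - Q₀) ^ 3 / (β * (SInf - Q₀) - S₁) ^ 3) β) ∧
    -- monotonicity and concavity in β
    StrictMonoOn R (Set.Ioi 0) ∧ ConcaveOn ℝ (Set.Ioi 0) R ∧ StrictMonoOn Q (Set.Ioi 0) := by
  obtain rfl : Q = fun β => SlipFlow.H1.integral (u β) := funext hQ
  obtain rfl : R = SlipFlow.lowerBoundR m SInf S₁ Q₀ := funext hR
  have hA := Ω.area_pos
  have hP := Ω.perimeter_pos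
  have hpos : 0 < Q₀ := hQ₀ ▸ h₀.integral_pos
  have hD : Q₀ ≤ SInf := hQ₀ ▸ hSInf ▸ h₀.integral_le hInf
  have hS : S₁ ≤ 0 := hS₁ ▸ neg_nonpos.2 (SlipFlow.functionalB_nonneg uInf)
  have hm0 : 0 < m := hm ▸ by positivity
  have hB : SlipFlow.functionalB uInf = -S₁ := by rw [hS₁, neg_neg]
  refine ⟨hA, hP, hpos, hD, hS, fun β hβ => ?_, SlipFlow.strictMonoOn_lowerBoundR hD hS hm0,
    SlipFlow.concaveOn_lowerBoundR hD hS, SlipFlow.strictMonoOn_integral_of_solvesP hu⟩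
  set d := β * (SInf - Q₀) - S₁ with hd
  have hd0 : 0 ≤ d := by linarith [mul_nonneg hβ.le (sub_nonneg.2 hD)]
  -- The functional is `R(β)` minus three weighted squares; the bound, the maximum and its
  -- maximisers are read off from this.
  have hJ : ∀ c s t : ℝ, SlipFlow.functionalJ β
      (SlipFlow.H1.const Ω c + s • u₀ + t • uInf) = SlipFlow.lowerBoundR m SInf S₁ Q₀ β -
        (Ω.perimeter / β * (c - β * (Ω.area / Ω.perimeter)) ^ 2 + Q₀ * (s + t - 1) ^ 2 +
          d / β * (t - β * (SInf - Q₀) / d) ^ 2) := fun c s t => by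
    have h1 := SlipFlow.functionalJ_combination h₀ hInf hβ c s t
    have h2 := SlipFlow.quadratic_eq_lowerBoundR (m := m) hD hS hβ t
    rw [← hQ₀, ← hSInf, hB, ← hm] at h1
    linarith
  have n1 : ∀ c : ℝ, 0 ≤ Ω.perimeter / β * (c - β * (Ω.area / Ω.perimeter)) ^ 2 :=
    fun c => by positivity
  have n2 : ∀ s t : ℝ, 0 ≤ Q₀ * (s + t - 1) ^ 2 := fun s t => by positivity
  have n3 : ∀ t : ℝ, 0 ≤ d / β * (t - β * (SInf - Q₀) / d) ^ 2 := fun t => by positivity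
  have hle : ∀ c s t : ℝ, SlipFlow.functionalJ β
      (SlipFlow.H1.const Ω c + s • u₀ + t • uInf) ≤ SlipFlow.lowerBoundR m SInf S₁ Q₀ β :=
    fun c s t => by linarith [hJ c s t, n1 c, n2 s t, n3 t]
  -- The triple annihilates all three squares. If `d = 0`, the quotient is `0` by convention and the
  -- third weight vanishes.
  have hattained : SlipFlow.functionalJ β
      (SlipFlow.H1.const Ω (β * (Ω.area / Ω.perimeter)) + (1 - β * (SInf - Q₀) / d) • u₀ +
        (β * (SInf - Q₀) / d) • uInf) = SlipFlow.lowerBoundR m SInf S₁ Q₀ β := by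
    rw [hJ]
    ring
  have hmax : ∀ c s t : ℝ, SlipFlow.functionalJ β
      (SlipFlow.H1.const Ω c + s • u₀ + t • uInf) = SlipFlow.lowerBoundR m SInf S₁ Q₀ β →
      c = β * (Ω.area / Ω.perimeter) ∧ s + t = 1 := fun c s t h => by
    have h1 : Ω.perimeter / β * (c - β * (Ω.area / Ω.perimeter)) ^ 2 = 0 :=
      le_antisymm (by linarith [hJ c s t, n2 s t, n3 t]) (n1 c)
    have h2 : Q₀ * (s + t - 1) ^ 2 = 0 :=
      le_antisymm (by linarith [hJ c s t, n1 c, n3 t]) (n2 s t)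
    have hPβ : Ω.perimeter / β ≠ 0 := (div_pos hP hβ).ne'
    exact ⟨sub_eq_zero.1 (pow_eq_zero_iff two_ne_zero |>.1 ((mul_eq_zero.1 h1).resolve_left hPβ)),
      sub_eq_zero.1 (pow_eq_zero_iff two_ne_zero |>.1
        ((mul_eq_zero.1 h2).resolve_left hpos.ne'))⟩
  refine ⟨?_, ⟨⟨(_, _, _), hattained⟩, ?_⟩, hmax, fun hne => ⟨(_, _, _), hattained, ?_⟩,
    SlipFlow.lowerBoundR_eq hD hS hβ, SlipFlow.add_mul_le_lowerBoundR hD hS hβ,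
    fun h => SlipFlow.add_mul_lt_lowerBoundR (hD.lt_of_ne' h) hS hβ,
    SlipFlow.expansion_le_lowerBoundR hD hS hβ,
    fun h => SlipFlow.expansion_lt_lowerBoundR hD (hS.lt_of_ne h) hβ,
    (SlipFlow.hasDerivAt_lowerBoundR_of_pos hD hS hβ).differentiableAt,
    SlipFlow.hasDerivAt_deriv_lowerBoundR hD hS hβ⟩
  · exact hattained ▸ (hu β hβ).functionalJ_le hβ _
  · rintro _ ⟨p, rfl⟩
    exact hle _ _ _
  · rintro ⟨c, s, t⟩ h
    obtain ⟨hc, hst⟩ := hmax c s t h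
    have h3 : d / β * (t - β * (SInf - Q₀) / d) ^ 2 = 0 :=
      le_antisymm (by linarith [hJ c s t, n1 c, n2 s t]) (n3 t)
    -- Only here is `d ≠ 0` needed: otherwise the third square puts no constraint on `t`.
    have hdβ : d / β ≠ 0 := div_ne_zero hne hβ.ne'
    have ht : t = β * (SInf - Q₀) / d :=
      sub_eq_zero.1 (pow_eq_zero_iff two_ne_zero |>.1 ((mul_eq_zero.1 h3).resolve_left hdβ))
    have hs : s = 1 - β * (SInf - Q₀) / d := by linarith
    rw [hc, hs, ht]
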